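/- Let $n\ge 1$ and let $$K_n:=\Big\{x\in\mathbb R^n \;:\; \sum_{i=1}^{n-1}x_i^2\le x_n^2,\ x_n\ge 0\Big\}$$ be the ice-cream (Lorentz) cone. Let $A\in\mathbb R^{n\times n}$ be such that $K_n$ is an invariant set of the linear system $\dot x=Ax$ (written $A\in M(K_n)$), that is, every solution with $x(0)\in K_n$ satisfies $x(t)\in K_n$ for all $t\ge 0$. Suppose that $A$ is Hurwitz, that is, every complex eigenvalue of $A$ has negative real part. Then there exists a matrix $P\in\mathbb R^{n\times n}$ such that $V(x):=x^TPx$ is a Lyapunov function for $\dot x=Ax$, that is, $V(x)>0$ and $\nabla V(x)^TAx<0$ for all $x\in\mathbb R^n\setminus\{0\}$, and either $P=I_n$, or there is a vector $b\in\mathbb R^{n-1}\setminus\{0\}$ such that, with $\bar b:=b/\|b\|_2$, $$P= I_n+\begin{bmatrix}\bar b\,\bar b^T&0\\ 0&1\end{bmatrix}\big(\cosh(\|b\|_2)-1\big)+\begin{bmatrix}0&\bar b\\ \bar b^T&0\end{bmatrix}\sinh(\|b\|_2).$$ -/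

import Mathlib

open scoped Matrix

namespace IceCream

/-- The ice-cream cone in `ℝ^(m+1)`: the last coordinate is nonnegative and its square dominates
the sum of the squares of the first `m` coordinates. -/
def iceCreamCone (m : ℕ) : Set (Fin (m + 1) → ℝ) :=
  {x | ∑ i : Fin m, x i.castSucc ^ 2 ≤ x (Fin.last m) ^ 2 ∧ 0 ≤ x (Fin.last m)}

/-- `x` is a solution on `[0, ∞)` of the linear system `ẋ = A x`. -/
def IsSolution {n : ℕ} (A : Matrix (Fin n) (Fin n) ℝ) (x : ℝ → Fin n → ℝ) : Prop :=
  ∀ t : ℝ, 0 ≤ t → HasDerivWithinAt x (A *ᵥ x t) (Set.Ici 0) t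

/-- The set `M(C)` of matrices `A` for which `C` is an invariant set of `ẋ = A x`:
every solution that starts in `C` stays in `C` for all `t ≥ 0`. -/
def invariantMatrices {n : ℕ} (C : Set (Fin n → ℝ)) : Set (Matrix (Fin n) (Fin n) ℝ) :=
  {A | ∀ x : ℝ → Fin n → ℝ, IsSolution A x → x 0 ∈ C → ∀ t : ℝ, 0 ≤ t → x t ∈ C}

/-- A real matrix is Hurwitz if all its complex eigenvalues have negative real part. -/
def IsHurwitz {n : ℕ} (A : Matrix (Fin n) (Fin n) ℝ) : Prop :=
  ∀ z ∈ spectrum ℂ (A.map Complex.ofReal), z.re < 0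

/-- `V` is a (strict, global) Lyapunov function for `ẋ = A x`: it is continuously differentiable,
positive definite, and its derivative along the vector field `x ↦ A x` is negative definite. -/
structure IsLyapunovFunction {n : ℕ} (A : Matrix (Fin n) (Fin n) ℝ)
    (V : (Fin n → ℝ) → ℝ) : Prop where
  contDiff : ContDiff ℝ 1 V
  map_zero : V 0 = 0
  pos : ∀ x, x ≠ 0 → 0 < V x
  deriv_neg : ∀ x, x ≠ 0 → fderiv ℝ V x (A *ᵥ x) < 0

/-- The normalized vector `b / ‖b‖₂`. -/
noncomputable def unitVec {m : ℕ} (b : EuclideanSpace ℝ (Fin m)) : Fin m → ℝ :=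
  fun i => b i / ‖b‖

/-- The matrix of size `(m + 1) × (m + 1)` given in block form, with blocks of sizes `m` and `1`. -/
def ofBlocks {m : ℕ} (B : Matrix (Fin m) (Fin m) ℝ) (c r : Fin m → ℝ) (d : ℝ) :
    Matrix (Fin (m + 1)) (Fin (m + 1)) ℝ :=
  Matrix.reindex finSumFinEquiv finSumFinEquiv
    (Matrix.fromBlocks B (Matrix.replicateCol (Fin 1) c) (Matrix.replicateRow (Fin 1) r)
      (Matrix.of fun _ _ => d))

/-- The boost matrix
`I + [b̄ b̄ᵀ, 0; 0, 1] (cosh ‖b‖₂ - 1) + [0, b̄; b̄ᵀ, 0] sinh ‖b‖₂`, where `b̄ = b / ‖b‖₂`. -/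
noncomputable def boostMatrix {m : ℕ} (b : EuclideanSpace ℝ (Fin m)) :
    Matrix (Fin (m + 1)) (Fin (m + 1)) ℝ :=
  1 + (Real.cosh ‖b‖ - 1) • ofBlocks (Matrix.vecMulVec (unitVec b) (unitVec b)) 0 0 1
    + Real.sinh ‖b‖ • ofBlocks 0 (unitVec b) (unitVec b) 0

end IceCream

/-!
Write `K` for the cone. Invariance of `K` makes `A` cross-positive: `⟨y, A x⟩ ≥ 0` for orthogonal
`x`, `y` in `K` (`crossPositive_of_mem_invariantMatrices`); as `K` is self-dual, `Aᵀ` is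
cross-positive too. A cross-positive Hurwitz matrix maps some interior vector of `K` into the
interior of `-K` (`CrossPositive.exists_gap_pos`), so there are interior vectors `v` and `w` with
`A v` and `Aᵀ w` in the interior of `-K`. Both can be scaled to the hyperboloid
`xₙ² - ‖x'‖² = 1`, on which boosts act transitively (`exists_boostMatrix_mulVec_eq`), so `P v = w`
for some `P` that is a boost or the identity.

This `P` is positive definite and maps `K` and its boundary into themselves, and
`(P A + Aᵀ P) v` is negative in the following sense: for `u ≠ 0` in `K`,
`⟨u, (P A + Aᵀ P) v⟩ = ⟨P u, A v⟩ + ⟨u, Aᵀ w⟩ < 0`, as `P u` lies in `K`. Let `μ` be the maximum of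
the quotient of the forms of `P A + Aᵀ P` and of `P`, attained at a generalized eigenvector `z`,
which may be taken outside `K`. Some `x = t v + z` with `t > 0` is on the boundary of `K`. Testing
`(P A + Aᵀ P) x` against a vector `u` of `K` orthogonal to `P x` gives a nonnegative number, by
cross-positivity of `A` and `Aᵀ`, and this forces `μ < 0` (`isLyapunovFunction_of_mulVec_eq`). Hence
`x ↦ xᵀ P x` decreases strictly along the flow.
-/

namespace IceCream

/-! ### The gap function of the cone -/

/-- The first `m` coordinates of a vector, as an element of Euclidean space. -/
noncomputable def spatial {m : ℕ} (x : Fin (m + 1) → ℝ) : EuclideanSpace ℝ (Fin m) :=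
  WithLp.toLp 2 fun i => x i.castSucc

/-- The signed quantity `xₙ - ‖(x₁, …, xₙ₋₁)‖₂`: it is nonnegative on the cone, zero on its
boundary and positive on its interior. -/
noncomputable def gap {m : ℕ} (x : Fin (m + 1) → ℝ) : ℝ := x (Fin.last m) - ‖spatial x‖

/-- The axis vector `(0, …, 0, 1)`. -/
def axis (m : ℕ) : Fin (m + 1) → ℝ := Pi.single (Fin.last m) 1

variable {m : ℕ}

@[simp] lemma spatial_apply (x : Fin (m + 1) → ℝ) (i : Fin m) : spatial x i = x i.castSucc := rfl

@[simp] lemma spatial_add (x y : Fin (m + 1) → ℝ) : spatial (x + y) = spatial x + spatial y := rfl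

@[simp] lemma spatial_smul (c : ℝ) (x : Fin (m + 1) → ℝ) : spatial (c • x) = c • spatial x := rfl

@[simp] lemma spatial_axis : spatial (axis m) = 0 := by
  ext i; simp [axis]

@[simp] lemma axis_last : axis m (Fin.last m) = 1 := by simp [axis]

lemma ext_spatial {x y : Fin (m + 1) → ℝ} (h : spatial x = spatial y)
    (hl : x (Fin.last m) = y (Fin.last m)) : x = y := by
  funext i
  refine Fin.lastCases hl (fun j => ?_) i
  simpa using congrArg (fun z : EuclideanSpace ℝ (Fin m) => z j) h

lemma exists_spatial (p : EuclideanSpace ℝ (Fin m)) (c : ℝ) :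
    ∃ x : Fin (m + 1) → ℝ, spatial x = p ∧ x (Fin.last m) = c :=
  ⟨Fin.snoc (α := fun _ => ℝ) p c, by ext i; simp, by simp⟩

lemma dotProduct_eq_inner_add (x y : Fin (m + 1) → ℝ) :
    x ⬝ᵥ y = inner ℝ (spatial x) (spatial y) + x (Fin.last m) * y (Fin.last m) := by
  simp [dotProduct, Fin.sum_univ_castSucc, PiLp.inner_apply, mul_comm]

@[fun_prop] lemma continuous_spatial : Continuous (spatial (m := m)) := by
  unfold spatial; fun_prop

@[fun_prop] lemma continuous_gap : Continuous (gap (m := m)) := by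
  unfold gap; fun_prop

lemma mem_iceCreamCone_iff {x : Fin (m + 1) → ℝ} : x ∈ iceCreamCone m ↔ 0 ≤ gap x := by
  have h : ∑ i : Fin m, x i.castSucc ^ 2 = ‖spatial x‖ ^ 2 := by
    simp [EuclideanSpace.norm_sq_eq]
  simp only [iceCreamCone, Set.mem_ofPred_eq, h, gap, sub_nonneg]
  exact ⟨fun ⟨h1, h2⟩ => le_of_sq_le_sq h1 h2,
    fun h1 => ⟨pow_le_pow_left₀ (norm_nonneg _) h1 2, (norm_nonneg _).trans h1⟩⟩

lemma gap_axis : gap (axis m) = 1 := by simp [gap]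

lemma gap_smul {c : ℝ} (hc : 0 ≤ c) (x : Fin (m + 1) → ℝ) : gap (c • x) = c * gap x := by
  simp [gap, norm_smul, abs_of_nonneg hc, mul_sub]

lemma add_gap_le_gap_add (x y : Fin (m + 1) → ℝ) : gap x + gap y ≤ gap (x + y) := by
  have := norm_add_le (spatial x) (spatial y)
  simp only [gap, spatial_add, Pi.add_apply]
  linarith

lemma dotProduct_nonneg_of_gap {x y : Fin (m + 1) → ℝ} (hx : 0 ≤ gap x) (hy : 0 ≤ gap y) :
    0 ≤ x ⬝ᵥ y := by
  rw [dotProduct_eq_inner_add]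
  have h := (abs_le.1 (abs_real_inner_le_norm (spatial x) (spatial y))).1
  have := mul_le_mul (sub_nonneg.1 hx) (sub_nonneg.1 hy) (norm_nonneg _)
    ((norm_nonneg _).trans (sub_nonneg.1 hx))
  linarith

lemma last_pos_of_gap {x : Fin (m + 1) → ℝ} (hx : 0 ≤ gap x) (h0 : x ≠ 0) :
    0 < x (Fin.last m) := by
  have h1 := norm_nonneg (spatial x)
  unfold gap at hx
  refine lt_of_le_of_ne (by linarith) fun h => h0 ?_
  have h2 : ‖spatial x‖ = 0 := by linarith
  exact ext_spatial (by rw [norm_eq_zero.1 h2]; rfl) h.symm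

lemma dotProduct_pos_of_gap {x y : Fin (m + 1) → ℝ} (hx : 0 ≤ gap x) (h0 : x ≠ 0)
    (hy : 0 < gap y) : 0 < x ⬝ᵥ y := by
  rw [dotProduct_eq_inner_add]
  have h := (abs_le.1 (abs_real_inner_le_norm (spatial x) (spatial y))).1
  have h1 := mul_le_mul_of_nonneg_right (sub_nonneg.1 hx) (norm_nonneg (spatial y))
  have h2 := mul_lt_mul_of_pos_left (sub_pos.1 hy) (last_pos_of_gap hx h0)
  linarith

/-- A supporting functional at a boundary point: the mirror image of the point in the axis, or the
axis itself when the point is the apex. -/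
lemma exists_orthogonal_of_gap_eq_zero {x : Fin (m + 1) → ℝ} (hx : gap x = 0) :
    ∃ y : Fin (m + 1) → ℝ, 0 ≤ gap y ∧ y ≠ 0 ∧ y ⬝ᵥ x = 0 := by
  by_cases h0 : x = 0
  · refine ⟨axis m, by rw [gap_axis]; exact zero_le_one, fun h => ?_, by simp [h0]⟩
    exact one_ne_zero ((axis_last (m := m)).symm.trans (congrFun h _))
  · obtain ⟨y, hy, hyl⟩ := exists_spatial (-spatial x) (x (Fin.last m))
    refine ⟨y, ?_, fun h => ?_, ?_⟩
    · rw [← hx, gap, gap, hy, hyl, norm_neg]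
    · have := last_pos_of_gap hx.ge h0
      rw [← hyl, h] at this
      exact lt_irrefl _ this
    · have : x (Fin.last m) = ‖spatial x‖ := sub_eq_zero.1 hx
      rw [dotProduct_eq_inner_add, hy, hyl, inner_neg_left, real_inner_self_eq_norm_sq, this]
      ring

/-! ### Cross-positivity -/

/-- `A` is cross-positive on the cone: `⟨y, A x⟩ ≥ 0` for orthogonal elements `x`, `y` of the cone.
The self-duality of the cone is built in, as both vectors range over the same cone. -/
def CrossPositive (A : Matrix (Fin (m + 1)) (Fin (m + 1)) ℝ) : Prop :=
  ∀ x y : Fin (m + 1) → ℝ, 0 ≤ gap x → 0 ≤ gap y → y ⬝ᵥ x = 0 → 0 ≤ y ⬝ᵥ (A *ᵥ x)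

lemma CrossPositive.transpose {A : Matrix (Fin (m + 1)) (Fin (m + 1)) ℝ} (hA : CrossPositive A) :
    CrossPositive Aᵀ := by
  intro x y hx hy h
  have := hA y x hy hx (by rwa [dotProduct_comm])
  rwa [Matrix.mulVec_transpose, dotProduct_comm, ← Matrix.dotProduct_mulVec]

/-- The solution is `t ↦ exp (t A) x₀`. The exponential is taken in the algebra of continuous linear
maps, which carries a norm, unlike the matrices. -/
lemma exists_isSolution {n : ℕ} (A : Matrix (Fin n) (Fin n) ℝ) (x₀ : Fin n → ℝ) :
    ∃ x : ℝ → Fin n → ℝ, x 0 = x₀ ∧ ∀ t, HasDerivAt x (A *ᵥ x t) t := by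
  let L : (Fin n → ℝ) →L[ℝ] (Fin n → ℝ) := LinearMap.toContinuousLinearMap A.mulVecLin
  refine ⟨fun t => NormedSpace.exp (t • L) x₀, by simp, fun t => ?_⟩
  have h := (hasDerivAt_exp_smul_const' (𝕂 := ℝ) L t).clm_apply (hasDerivAt_const t x₀)
  simpa [L] using h

/-- Along the solution from `x`, the pairing with `y` is nonnegative and starts at zero, so its
initial derivative `⟨y, A x⟩` is nonnegative. -/
lemma crossPositive_of_mem_invariantMatrices {A : Matrix (Fin (m + 1)) (Fin (m + 1)) ℝ}
    (hM : A ∈ invariantMatrices (iceCreamCone m)) : CrossPositive A := by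
  intro x₀ y hx hy h0
  obtain ⟨x, rfl, hd⟩ := exists_isSolution A x₀
  have hK := hM x (fun t _ => (hd t).hasDerivWithinAt) (mem_iceCreamCone_iff.2 hx)
  have hder : HasDerivAt (fun t => y ⬝ᵥ x t) (y ⬝ᵥ (A *ᵥ x 0)) 0 := by
    simp only [dotProduct]
    exact HasDerivAt.fun_sum fun i _ => ((hasDerivAt_pi.1 (hd 0)) i).const_mul (y i)
  have hslope : Filter.Tendsto (slope (fun t => y ⬝ᵥ x t) 0) (nhdsWithin 0 (Set.Ioi 0))
      (nhds (y ⬝ᵥ (A *ᵥ x 0))) :=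
    hder.tendsto_slope.mono_left (nhdsWithin_mono _ fun t (ht : 0 < t) => ht.ne')
  refine ge_of_tendsto hslope ?_
  filter_upwards [self_mem_nhdsWithin] with t ht
  have ht : 0 < t := ht
  rw [slope_def_field, h0, sub_zero, sub_zero]
  exact div_nonneg (dotProduct_nonneg_of_gap hy (mem_iceCreamCone_iff.1 (hK t ht.le))) ht.le

/-! ### Interior vectors mapped into the negative of the cone -/

lemma IsHurwitz.det_ne_zero {n : ℕ} {A : Matrix (Fin n) (Fin n) ℝ} (hA : IsHurwitz A) {l : ℝ}
    (hl : 0 ≤ l) : (l • (1 : Matrix (Fin n) (Fin n) ℝ) - A).det ≠ 0 := by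
  intro h
  refine (hA l ?_).not_ge (by simpa using hl)
  rw [spectrum.mem_iff, Matrix.isUnit_iff_isUnit_det, isUnit_iff_ne_zero, not_not]
  have h2 := congrArg Complex.ofRealHom h
  rw [RingHom.map_det, map_zero] at h2
  rw [← h2]
  congr 1
  ext i j
  by_cases hij : i = j <;> simp [Matrix.algebraMap_matrix_apply, hij]

/-- The solution `v(s)` of `(s - (1 - s) A) v = e`, with `e` the axis, moves continuously from
`v(1) = e` to `v(0) = -A⁻¹ e`, and cross-positivity keeps it off the boundary of the cone. -/
lemma CrossPositive.exists_gap_pos {A : Matrix (Fin (m + 1)) (Fin (m + 1)) ℝ}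
    (hA : CrossPositive A)
    (hdet : ∀ l : ℝ, 0 ≤ l → (l • (1 : Matrix (Fin (m + 1)) (Fin (m + 1)) ℝ) - A).det ≠ 0) :
    ∃ v, 0 < gap v ∧ A *ᵥ v = -axis m := by
  let B : ℝ → Matrix (Fin (m + 1)) (Fin (m + 1)) ℝ := fun s => s • 1 - (1 - s) • A
  have hB : ∀ s ∈ Set.Icc (0 : ℝ) 1, (B s).det ≠ 0 := by
    rintro s ⟨h0, h1⟩
    rcases h1.eq_or_lt with rfl | h1
    · simp [B]
    · have hs : 0 < 1 - s := by linarith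
      have : B s = (1 - s) • ((s / (1 - s)) • (1 : Matrix _ _ ℝ) - A) := by
        simp only [B, smul_sub, smul_smul]
        rw [mul_div_cancel₀ _ hs.ne']
      rw [this, Matrix.det_smul]
      exact mul_ne_zero (pow_ne_zero _ hs.ne') (hdet _ (by positivity))
  -- By Cramer's rule `v s` depends continuously on `s`.
  let v : ℝ → Fin (m + 1) → ℝ := fun s => (B s).det⁻¹ • ((B s).adjugate *ᵥ axis m)
  have hv : ∀ s ∈ Set.Icc (0 : ℝ) 1, s • v s - (1 - s) • (A *ᵥ v s) = axis m := by
    intro s hs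
    have : B s *ᵥ v s = axis m := by
      simp only [v, Matrix.mulVec_smul, Matrix.mulVec_mulVec, Matrix.mul_adjugate,
        Matrix.smul_mulVec, Matrix.one_mulVec]
      rw [smul_smul, inv_mul_cancel₀ (hB s hs), one_smul]
    rwa [Matrix.sub_mulVec, Matrix.smul_mulVec, Matrix.smul_mulVec, Matrix.one_mulVec] at this
  have hBc : Continuous B := by fun_prop
  have hcont : ContinuousOn (fun s => gap (v s)) (Set.Icc 0 1) := by
    refine continuous_gap.comp_continuousOn ?_
    refine ContinuousOn.smul (hBc.matrix_det.continuousOn.inv₀ hB) ?_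
    exact (hBc.matrix_adjugate.matrix_mulVec continuous_const).continuousOn
  clear_value v
  have hne : ∀ s ∈ Set.Icc (0 : ℝ) 1, gap (v s) ≠ 0 := by
    intro s hs h
    obtain ⟨y, hy, hy0, hyv⟩ := exists_orthogonal_of_gap_eq_zero h
    have h1 := hA (v s) y h.ge hy hyv
    have h2 : 0 < y ⬝ᵥ axis m := dotProduct_pos_of_gap hy hy0 (by rw [gap_axis]; exact one_pos)
    rw [← hv s hs, dotProduct_sub, dotProduct_smul, dotProduct_smul, hyv] at h2
    have h3 := mul_nonneg (sub_nonneg.2 hs.2) h1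
    simp only [smul_eq_mul, mul_zero, zero_sub] at h2
    linarith
  have h1 : v 1 = axis m := by simpa using hv 1 (by simp)
  refine ⟨v 0, ?_, ?_⟩
  · by_contra h
    obtain ⟨s, hs, h0⟩ := intermediate_value_Icc zero_le_one hcont
      ⟨not_lt.1 h, by rw [h1, gap_axis]; exact zero_le_one⟩
    exact hne s hs h0
  · have := hv 0 (by simp)
    simp only [zero_smul, sub_zero, one_smul, zero_sub] at this
    rw [← this, neg_neg]

/-- The vector of the previous lemma, rescaled to lie on the unit hyperboloid. -/
lemma CrossPositive.exists_hyperboloid {A : Matrix (Fin (m + 1)) (Fin (m + 1)) ℝ}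
    (hA : CrossPositive A)
    (hdet : ∀ l : ℝ, 0 ≤ l → (l • (1 : Matrix (Fin (m + 1)) (Fin (m + 1)) ℝ) - A).det ≠ 0) :
    ∃ v, 0 < gap v ∧ v (Fin.last m) ^ 2 = 1 + ‖spatial v‖ ^ 2 ∧
      ∃ c : ℝ, 0 < c ∧ A *ᵥ v = -(c • axis m) := by
  obtain ⟨v, hv, hAv⟩ := hA.exists_gap_pos hdet
  have hq : 0 < v (Fin.last m) ^ 2 - ‖spatial v‖ ^ 2 :=
    sub_pos.2 (pow_lt_pow_left₀ (sub_pos.1 hv) (norm_nonneg _) two_ne_zero)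
  set q := v (Fin.last m) ^ 2 - ‖spatial v‖ ^ 2 with hqdef
  have hc : 0 < (√q)⁻¹ := inv_pos.2 (Real.sqrt_pos.2 hq)
  refine ⟨(√q)⁻¹ • v, ?_, ?_, (√q)⁻¹, hc, ?_⟩
  · rw [gap_smul hc.le]; positivity
  · rw [spatial_smul, norm_smul, Real.norm_of_nonneg hc.le, Pi.smul_apply, smul_eq_mul, mul_pow,
      mul_pow, inv_pow, Real.sq_sqrt hq.le]
    field_simp
    linarith
  · rw [Matrix.mulVec_smul, hAv, smul_neg]

/-! ### Boosts -/

lemma boostMatrix_transpose (b : EuclideanSpace ℝ (Fin m)) :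
    (boostMatrix b)ᵀ = boostMatrix b := by
  simp only [boostMatrix, ofBlocks, Matrix.transpose_add, Matrix.transpose_smul,
    Matrix.transpose_one, Matrix.transpose_reindex, Matrix.fromBlocks_transpose,
    Matrix.transpose_vecMulVec, Matrix.transpose_replicateCol, Matrix.transpose_replicateRow,
    Matrix.transpose_zero]
  rfl

lemma ofBlocks_mulVec_last (B : Matrix (Fin m) (Fin m) ℝ) (c r : Fin m → ℝ) (d : ℝ)
    (x : Fin (m + 1) → ℝ) :
    (ofBlocks B c r d *ᵥ x) (Fin.last m) =
      r ⬝ᵥ (fun i => x i.castSucc) + d * x (Fin.last m) := by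
  have h : ∀ j : Fin m, finSumFinEquiv.symm j.castSucc = (Sum.inl j : Fin m ⊕ Fin 1) :=
    fun j => finSumFinEquiv_symm_apply_castAdd j
  simp [Matrix.mulVec, ofBlocks, dotProduct, Fin.sum_univ_castSucc, h]

lemma ofBlocks_mulVec_castSucc (B : Matrix (Fin m) (Fin m) ℝ) (c r : Fin m → ℝ) (d : ℝ)
    (x : Fin (m + 1) → ℝ) (i : Fin m) :
    (ofBlocks B c r d *ᵥ x) i.castSucc =
      (B *ᵥ (fun i => x i.castSucc)) i + c i * x (Fin.last m) := by
  have h : ∀ j : Fin m, finSumFinEquiv.symm j.castSucc = (Sum.inl j : Fin m ⊕ Fin 1) :=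
    fun j => finSumFinEquiv_symm_apply_castAdd j
  simp [Matrix.mulVec, ofBlocks, dotProduct, Fin.sum_univ_castSucc, h]

lemma unitVec_dotProduct (b : EuclideanSpace ℝ (Fin m)) (x : Fin (m + 1) → ℝ) :
    unitVec b ⬝ᵥ (fun i => x i.castSucc) = inner ℝ (‖b‖⁻¹ • b) (spatial x) := by
  simp [unitVec, dotProduct, PiLp.inner_apply, div_eq_inv_mul, mul_comm]

lemma boostMatrix_mulVec_last (b : EuclideanSpace ℝ (Fin m)) (x : Fin (m + 1) → ℝ) :
    (boostMatrix b *ᵥ x) (Fin.last m) = Real.cosh ‖b‖ * x (Fin.last m) +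
      Real.sinh ‖b‖ * inner ℝ (‖b‖⁻¹ • b) (spatial x) := by
  simp only [boostMatrix, Matrix.add_mulVec, Matrix.smul_mulVec, Matrix.one_mulVec, Pi.add_apply,
    Pi.smul_apply, ofBlocks_mulVec_last, unitVec_dotProduct, zero_dotProduct, smul_eq_mul]
  ring

lemma spatial_boostMatrix_mulVec (b : EuclideanSpace ℝ (Fin m)) (x : Fin (m + 1) → ℝ) :
    spatial (boostMatrix b *ᵥ x) = spatial x +
      ((Real.cosh ‖b‖ - 1) * inner ℝ (‖b‖⁻¹ • b) (spatial x) +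
        Real.sinh ‖b‖ * x (Fin.last m)) • (‖b‖⁻¹ • b) := by
  ext i
  simp only [boostMatrix, Matrix.add_mulVec, Matrix.smul_mulVec, Matrix.one_mulVec, spatial_apply,
    Pi.add_apply, Pi.smul_apply, ofBlocks_mulVec_castSucc, Matrix.vecMulVec_mulVec,
    unitVec_dotProduct, Matrix.zero_mulVec, Pi.zero_apply, smul_eq_mul, PiLp.add_apply,
    PiLp.smul_apply, unitVec, MulOpposite.smul_eq_mul_unop, MulOpposite.unop_op]
  ring

lemma norm_inv_norm_smul {b : EuclideanSpace ℝ (Fin m)} (hb : b ≠ 0) : ‖‖b‖⁻¹ • b‖ = 1 :=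
  norm_smul_inv_norm (𝕜 := ℝ) hb

/-- A boost preserves the Lorentz form. -/
lemma boostMatrix_form {b : EuclideanSpace ℝ (Fin m)} (hb : b ≠ 0) (x : Fin (m + 1) → ℝ) :
    (boostMatrix b *ᵥ x) (Fin.last m) ^ 2 - ‖spatial (boostMatrix b *ᵥ x)‖ ^ 2 =
      x (Fin.last m) ^ 2 - ‖spatial x‖ ^ 2 := by
  rw [spatial_boostMatrix_mulVec, boostMatrix_mulVec_last, norm_add_sq_real, norm_smul, mul_pow,
    norm_inv_norm_smul hb, inner_smul_right,
    real_inner_comm (‖b‖⁻¹ • b) (spatial x), Real.norm_eq_abs, sq_abs]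
  linear_combination (x (Fin.last m) ^ 2 - inner ℝ (‖b‖⁻¹ • b) (spatial x) ^ 2) *
    Real.cosh_sq_sub_sinh_sq ‖b‖

/-- A boost of rapidity `r` scales the last coordinate of a vector of the cone by at least
`cosh r - sinh r`. -/
lemma boostMatrix_last_nonneg {b : EuclideanSpace ℝ (Fin m)} (hb : b ≠ 0) {x : Fin (m + 1) → ℝ}
    (hx : 0 ≤ gap x) : 0 ≤ (boostMatrix b *ᵥ x) (Fin.last m) := by
  have h := (abs_le.1 (abs_real_inner_le_norm (‖b‖⁻¹ • b) (spatial x))).1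
  rw [norm_inv_norm_smul hb, one_mul] at h
  have hs : 0 ≤ Real.sinh ‖b‖ := Real.sinh_nonneg_iff.2 (norm_nonneg b)
  have hx' : ‖spatial x‖ ≤ x (Fin.last m) := sub_nonneg.1 hx
  have h1 := mul_le_mul_of_nonneg_left ((neg_le_neg hx').trans h) hs
  have h2 := mul_nonneg (sub_nonneg.2 (Real.sinh_lt_cosh ‖b‖).le) ((norm_nonneg _).trans hx')
  rw [boostMatrix_mulVec_last]
  linarith

lemma gap_nonneg_boostMatrix {b : EuclideanSpace ℝ (Fin m)} (hb : b ≠ 0) {x : Fin (m + 1) → ℝ}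
    (hx : 0 ≤ gap x) : 0 ≤ gap (boostMatrix b *ᵥ x) := by
  have h := boostMatrix_form hb x
  have h1 := pow_le_pow_left₀ (norm_nonneg _) (sub_nonneg.1 hx) 2
  exact sub_nonneg.2 (le_of_sq_le_sq (by linarith) (boostMatrix_last_nonneg hb hx))

lemma gap_boostMatrix_eq_zero {b : EuclideanSpace ℝ (Fin m)} (hb : b ≠ 0)
    {x : Fin (m + 1) → ℝ} (hx : gap x = 0) : gap (boostMatrix b *ᵥ x) = 0 := by
  have h := boostMatrix_form hb x
  rw [sub_eq_zero.1 hx, sub_self, sub_eq_zero] at h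
  exact sub_eq_zero.2 ((sq_eq_sq₀ (boostMatrix_last_nonneg hb hx.ge) (norm_nonneg _)).1 h)

/-- With `s` the component of the spatial part along `b`, the form is bounded below by
`cosh r (s² + xₙ²) + 2 sinh r s xₙ = (exp r (s + xₙ)² + exp (-r) (s - xₙ)²) / 2`. -/
lemma boostMatrix_posDef {b : EuclideanSpace ℝ (Fin m)} (hb : b ≠ 0) {x : Fin (m + 1) → ℝ}
    (hx : x ≠ 0) : 0 < x ⬝ᵥ (boostMatrix b *ᵥ x) := by
  rw [dotProduct_eq_inner_add, spatial_boostMatrix_mulVec, boostMatrix_mulVec_last,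
    inner_add_right, inner_smul_right, real_inner_self_eq_norm_sq,
    real_inner_comm (‖b‖⁻¹ • b) (spatial x)]
  have h := abs_real_inner_le_norm (‖b‖⁻¹ • b) (spatial x)
  rw [norm_inv_norm_smul hb, one_mul] at h
  -- By Cauchy–Schwarz `s² ≤ ‖x'‖²`, which gives the lower bound.
  have h2 := sq_le_sq' (abs_le.1 h).1 (abs_le.1 h).2
  set s : ℝ := inner ℝ (‖b‖⁻¹ • b) (spatial x)
  set y := x (Fin.last m) with hy
  rw [Real.cosh_eq, Real.sinh_eq]
  have e1 := Real.exp_pos ‖b‖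
  have e2 := Real.exp_pos (-‖b‖)
  by_contra hle
  have h3 := mul_nonneg e1.le (sq_nonneg (s + y))
  have h4 := mul_nonneg e2.le (sq_nonneg (s - y))
  have h5 : (s + y) = 0 := by
    refine pow_eq_zero_iff two_ne_zero |>.1 (mul_eq_zero.1 (le_antisymm ?_ h3) |>.resolve_left e1.ne')
    nlinarith
  have h6 : (s - y) = 0 := by
    refine pow_eq_zero_iff two_ne_zero |>.1 (mul_eq_zero.1 (le_antisymm ?_ h4) |>.resolve_left e2.ne')
    nlinarith
  have hs : s = 0 := by linarith
  have hy0 : y = 0 := by linarith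
  rw [hs, hy0] at hle
  have h7 : ‖spatial x‖ = 0 :=
    pow_eq_zero_iff two_ne_zero |>.1 (le_antisymm (by linarith) (sq_nonneg _))
  exact hx (ext_spatial (by rw [norm_eq_zero.1 h7]; rfl) (hy.symm.trans hy0))

/-- Boosts act transitively on the unit hyperboloid. The boost taking `v` to `w` points in the
direction `w' - v'` of the difference of spatial parts. -/
lemma exists_boostMatrix_mulVec_eq {v w : Fin (m + 1) → ℝ} (hv : 0 < gap v) (hw : 0 < gap w)
    (hqv : v (Fin.last m) ^ 2 = 1 + ‖spatial v‖ ^ 2)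
    (hqw : w (Fin.last m) ^ 2 = 1 + ‖spatial w‖ ^ 2) (hne : spatial v ≠ spatial w) :
    ∃ b : EuclideanSpace ℝ (Fin m), b ≠ 0 ∧ boostMatrix b *ᵥ v = w := by
  obtain ⟨d, hd⟩ : ∃ d, spatial w = spatial v + d := ⟨_, (add_sub_cancel _ _).symm⟩
  have hd0 : d ≠ 0 := by rintro rfl; exact hne (by simpa using hd.symm)
  set k := ‖d‖ with hk
  have hkpos : 0 < k := norm_pos_iff.2 hd0
  set p := v (Fin.last m)
  set q := w (Fin.last m)
  have hp : ‖spatial v‖ < p := sub_pos.1 hv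
  have hq : ‖spatial w‖ < q := sub_pos.1 hw
  set g : ℝ := inner ℝ d (spatial v) with hg
  have hww : ‖spatial w‖ ^ 2 = ‖spatial v‖ ^ 2 + 2 * g + k ^ 2 := by
    rw [hd, norm_add_sq_real, hg, real_inner_comm]
  have hkle : k ≤ ‖spatial w‖ + ‖spatial v‖ := by
    have : d = spatial w - spatial v := by rw [hd]; abel
    rw [hk, this]; exact norm_sub_le _ _
  have hN : 0 < (p + q) ^ 2 - k ^ 2 :=
    sub_pos.2 (pow_lt_pow_left₀ (by linarith) hkpos.le two_ne_zero)
  set N := (p + q) ^ 2 - k ^ 2 with hNdef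
  have hNg : N = 2 * (g + (p + q) * p) := by
    rw [hNdef]; linear_combination hqw - hqv + hww
  have hpq : 0 < p + q := by
    have := norm_nonneg (spatial v); have := norm_nonneg (spatial w); linarith
  -- The half boost has hyperbolic sine `k / √N` and hyperbolic cosine `(p + q) / √N`.
  set S : ℝ := 2 * k * (p + q) / N with hS
  set C : ℝ := 1 + 2 * k ^ 2 / N with hC
  have hSpos : 0 < S := by positivity
  have hCpos : 0 < C := by positivity
  have hCS : 1 + S ^ 2 = C ^ 2 := by
    rw [hS, hC]; field_simp; rw [hNdef]; ring
  set r := Real.arsinh S with hr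
  have hrpos : 0 < r := Real.arsinh_pos_iff.2 hSpos
  have hsinh : Real.sinh r = S := Real.sinh_arsinh S
  have hcosh : Real.cosh r = C := by rw [hr, Real.cosh_arsinh, hCS, Real.sqrt_sq hCpos.le]
  have hnorm : ‖(r * k⁻¹) • d‖ = r := by
    rw [norm_smul, Real.norm_of_nonneg (by positivity), ← hk, mul_assoc,
      inv_mul_cancel₀ hkpos.ne', mul_one]
  have hunit : ‖(r * k⁻¹) • d‖⁻¹ • ((r * k⁻¹) • d) = k⁻¹ • d := by
    rw [hnorm, smul_smul, ← mul_assoc, inv_mul_cancel₀ hrpos.ne', one_mul]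
  refine ⟨(r * k⁻¹) • d, smul_ne_zero (by positivity) hd0, ext_spatial ?_ ?_⟩
  · rw [spatial_boostMatrix_mulVec, hunit, hnorm, hsinh, hcosh, inner_smul_left, hd, smul_smul]
    have : ((C - 1) * (k⁻¹ * g) + S * p) * k⁻¹ = 1 := by
      rw [hS, hC]; field_simp; rw [hNg]; ring
    simp only [conj_trivial]
    rw [this, one_smul]
  · rw [boostMatrix_mulVec_last, hunit, hnorm, hsinh, hcosh, inner_smul_left]
    simp only [conj_trivial]
    change C * p + S * (k⁻¹ * g) = q
    have hgN : g = N / 2 - (p + q) * p := by linarith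
    rw [hS, hC, hgN]; field_simp; rw [hNdef]; ring

/-! ### Quadratic Lyapunov functions from cross-positivity -/

lemma contDiff_quadratic {n : ℕ} (P : Matrix (Fin n) (Fin n) ℝ) :
    ContDiff ℝ 1 fun x : Fin n → ℝ => x ⬝ᵥ (P *ᵥ x) := by
  simp only [dotProduct, Matrix.mulVec]
  fun_prop

lemma dotProduct_mulVec_of_symm {n : ℕ} {P : Matrix (Fin n) (Fin n) ℝ} (hP : Pᵀ = P)
    (x y : Fin n → ℝ) : x ⬝ᵥ (P *ᵥ y) = (P *ᵥ x) ⬝ᵥ y := by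
  rw [Matrix.dotProduct_mulVec, ← Matrix.mulVec_transpose, hP]

lemma fderiv_quadratic {n : ℕ} {P : Matrix (Fin n) (Fin n) ℝ} (hP : Pᵀ = P) (x y : Fin n → ℝ) :
    fderiv ℝ (fun x : Fin n → ℝ => x ⬝ᵥ (P *ᵥ x)) x y = 2 * ((P *ᵥ x) ⬝ᵥ y) := by
  have hd : DifferentiableAt ℝ (fun x : Fin n → ℝ => x ⬝ᵥ (P *ᵥ x)) x :=
    ((contDiff_quadratic P).differentiable one_ne_zero) x
  rw [← hd.lineDeriv_eq_fderiv]
  have h : ∀ t : ℝ, (x + t • y) ⬝ᵥ (P *ᵥ (x + t • y)) =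
      x ⬝ᵥ (P *ᵥ x) + t * (2 * ((P *ᵥ x) ⬝ᵥ y)) + t ^ 2 * (y ⬝ᵥ (P *ᵥ y)) := by
    intro t
    simp only [Matrix.mulVec_add, Matrix.mulVec_smul, add_dotProduct, dotProduct_add,
      smul_dotProduct, dotProduct_smul, smul_eq_mul, dotProduct_mulVec_of_symm hP x y]
    rw [dotProduct_comm y (P *ᵥ x)]
    ring
  simp only [lineDeriv, h]
  have hder : HasDerivAt (fun t : ℝ => x ⬝ᵥ (P *ᵥ x) + t * (2 * ((P *ᵥ x) ⬝ᵥ y)) +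
      t ^ 2 * (y ⬝ᵥ (P *ᵥ y))) _ 0 := (((hasDerivAt_id (0 : ℝ)).mul_const (2 * ((P *ᵥ x) ⬝ᵥ y))).const_add
    (x ⬝ᵥ (P *ᵥ x))).add (((hasDerivAt_id (0 : ℝ)).pow 2).mul_const (y ⬝ᵥ (P *ᵥ y)))
  simpa using hder.deriv

/-- The maximum of the quotient of two quadratic forms is attained at a generalized eigenvector. -/
lemma exists_generalized_eigenvector {n : ℕ} {P C : Matrix (Fin (n + 1)) (Fin (n + 1)) ℝ}
    (hP : Pᵀ = P) (hC : Cᵀ = C) (hpos : ∀ x, x ≠ 0 → 0 < x ⬝ᵥ (P *ᵥ x)) :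
    ∃ (μ : ℝ) (z : Fin (n + 1) → ℝ), z ≠ 0 ∧ C *ᵥ z = μ • (P *ᵥ z) ∧
      ∀ x, x ⬝ᵥ (C *ᵥ x) ≤ μ * (x ⬝ᵥ (P *ᵥ x)) := by
  let f : (Fin (n + 1) → ℝ) → ℝ := fun x => (x ⬝ᵥ (C *ᵥ x)) / (x ⬝ᵥ (P *ᵥ x))
  have hne : ∀ x ∈ Metric.sphere (0 : Fin (n + 1) → ℝ) 1, x ≠ 0 := fun x hx =>
    ne_zero_of_mem_unit_sphere (⟨x, hx⟩ : Metric.sphere (0 : Fin (n + 1) → ℝ) 1)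
  have hf : ContinuousOn f (Metric.sphere 0 1) :=
    (contDiff_quadratic C).continuous.continuousOn.div
      (contDiff_quadratic P).continuous.continuousOn fun x hx => (hpos x (hne x hx)).ne'
  obtain ⟨z, hz, hmax⟩ := (isCompact_sphere (0 : Fin (n + 1) → ℝ) 1).exists_isMaxOn
    (NormedSpace.sphere_nonempty.2 zero_le_one) hf
  have hbound : ∀ x, x ⬝ᵥ (C *ᵥ x) ≤ f z * (x ⬝ᵥ (P *ᵥ x)) := by
    intro x
    by_cases hx : x = 0
    · simp [hx]
    have hx' : 0 < ‖x‖ := norm_pos_iff.2 hx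
    have h1 : f (‖x‖⁻¹ • x) ≤ f z := hmax (by simp [norm_smul, hx'.ne'])
    have h2 : f (‖x‖⁻¹ • x) = f x := by
      simp only [f, Matrix.mulVec_smul, smul_dotProduct, dotProduct_smul, smul_eq_mul]
      field_simp
    rw [h2] at h1
    exact (div_le_iff₀ (hpos x hx)).1 h1
  refine ⟨f z, z, hne z hz, ?_, hbound⟩
  have hpsd : (f z • P - C).PosSemidef := by
    refine Matrix.PosSemidef.of_dotProduct_mulVec_nonneg ?_ fun x => ?_
    · rw [Matrix.IsHermitian, Matrix.conjTranspose_eq_transpose_of_trivial, Matrix.transpose_sub,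
        Matrix.transpose_smul, hP, hC]
    · rw [star_trivial, Matrix.sub_mulVec, Matrix.smul_mulVec, dotProduct_sub, dotProduct_smul]
      exact sub_nonneg.2 (hbound x)
  have h0 : (f z • P - C) *ᵥ z = 0 := by
    rw [← hpsd.dotProduct_mulVec_zero_iff, star_trivial, Matrix.sub_mulVec, Matrix.smul_mulVec,
      dotProduct_sub, dotProduct_smul, smul_eq_mul, sub_eq_zero]
    exact div_mul_cancel₀ _ (hpos z (hne z hz)).ne'
  rw [Matrix.sub_mulVec, Matrix.smul_mulVec, sub_eq_zero] at h0
  exact h0.symm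

/-- The segment from a point outside the cone in an interior direction crosses the boundary. -/
lemma exists_gap_smul_add_eq_zero {v z : Fin (m + 1) → ℝ} (hv : 0 < gap v) (hz : gap z < 0) :
    ∃ t : ℝ, 0 < t ∧ gap (t • v + z) = 0 := by
  have hT : 0 < -gap z / gap v := div_pos (neg_pos.2 hz) hv
  have hc : ContinuousOn (fun t : ℝ => gap (t • v + z)) (Set.Icc 0 (-gap z / gap v)) := by fun_prop
  obtain ⟨t, ht, h0⟩ := intermediate_value_Icc hT.le hc (a := (0 : ℝ)) ⟨by simpa using hz.le, by
    have := add_gap_le_gap_add ((-gap z / gap v) • v) z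
    rw [gap_smul hT.le, div_mul_cancel₀ _ hv.ne'] at this
    linarith⟩
  refine ⟨t, lt_of_le_of_ne ht.1 ?_, h0⟩
  rintro rfl
  simp only [zero_smul, zero_add] at h0
  exact hz.ne h0

/-- A Perron–Frobenius argument: if `P v = w`, where `v` and `w` are interior vectors with
`A v ∈ -K` and `Aᵀ w ∈ -int K`, then every generalized eigenvalue of `P A + Aᵀ P` with respect to
`P` is negative. -/
lemma isLyapunovFunction_of_mulVec_eq {A P : Matrix (Fin (m + 1)) (Fin (m + 1)) ℝ}
    (hA : CrossPositive A) (hP : Pᵀ = P) (hpos : ∀ x, x ≠ 0 → 0 < x ⬝ᵥ (P *ᵥ x))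
    (hmono : ∀ x, 0 ≤ gap x → 0 ≤ gap (P *ᵥ x)) (hbdry : ∀ x, gap x = 0 → gap (P *ᵥ x) = 0)
    {v w : Fin (m + 1) → ℝ} (hv : 0 < gap v) (hw : 0 < gap w) (hPv : P *ᵥ v = w)
    (hAv : 0 ≤ gap (-(A *ᵥ v))) (hAw : 0 < gap (-(Aᵀ *ᵥ w))) :
    IsLyapunovFunction A fun x => x ⬝ᵥ (P *ᵥ x) := by
  have hform : ∀ x y, x ⬝ᵥ ((P * A + Aᵀ * P) *ᵥ y) =
      (P *ᵥ x) ⬝ᵥ (A *ᵥ y) + x ⬝ᵥ (Aᵀ *ᵥ (P *ᵥ y)) := by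
    intro x y
    rw [Matrix.add_mulVec, dotProduct_add, ← Matrix.mulVec_mulVec, ← Matrix.mulVec_mulVec,
      dotProduct_mulVec_of_symm hP]
  have hC : (P * A + Aᵀ * P)ᵀ = P * A + Aᵀ * P := by
    rw [Matrix.transpose_add, Matrix.transpose_mul, Matrix.transpose_mul, hP,
      Matrix.transpose_transpose]
    exact add_comm _ _
  obtain ⟨μ, z, hz0, hz, hmax⟩ := exists_generalized_eigenvector hP hC hpos
  -- One of `z` and `-z` lies outside the cone.
  obtain ⟨z, hzneg, hz⟩ : ∃ z, gap z < 0 ∧ (P * A + Aᵀ * P) *ᵥ z = μ • (P *ᵥ z) := by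
    by_cases h : gap z < 0
    · exact ⟨z, h, hz⟩
    · refine ⟨-z, ?_, by rw [Matrix.mulVec_neg, Matrix.mulVec_neg, hz, smul_neg]⟩
      have h1 := last_pos_of_gap (not_lt.1 h) hz0
      have h2 := norm_nonneg (spatial (-z))
      simp only [gap, Pi.neg_apply]
      linarith
  -- The functional `u` supports the cone at `P (t v + z)`, so `P u` supports it at `t v + z`.
  obtain ⟨t, ht, hx⟩ := exists_gap_smul_add_eq_zero hv hzneg
  obtain ⟨u, hu, hu0, hux⟩ := exists_orthogonal_of_gap_eq_zero (hbdry _ hx)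
  have h1 := hA (t • v + z) (P *ᵥ u) hx.ge (hmono u hu)
    (by rw [← dotProduct_mulVec_of_symm hP, hux])
  have h2 := hA.transpose (P *ᵥ (t • v + z)) u (hbdry _ hx).ge hu hux
  have h3 := hform u (t • v + z)
  have h4 := hform u v
  rw [Matrix.mulVec_add, Matrix.mulVec_smul, dotProduct_add, dotProduct_smul, hz, h4, hPv] at h3
  rw [Matrix.mulVec_add, Matrix.mulVec_smul, hPv, dotProduct_add, dotProduct_smul] at hux
  -- The identities `h3` and `hux` combine to
  -- `μ t ⟨u, w⟩ ≤ t (⟨P u, A v⟩ + ⟨u, Aᵀ w⟩)`, whose right-hand side is negative.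
  have h5 := dotProduct_nonneg_of_gap (hmono u hu) hAv
  have h6 := dotProduct_pos_of_gap hu hu0 hAw
  have h7 := dotProduct_pos_of_gap hu hu0 hw
  rw [dotProduct_neg] at h5 h6
  simp only [smul_eq_mul, dotProduct_smul] at h3 hux
  have hμ : μ < 0 := by
    by_contra hμ
    have h8 : 0 ≤ μ * (t * (u ⬝ᵥ w)) := mul_nonneg (not_lt.1 hμ) (by positivity)
    have h9 : μ * (u ⬝ᵥ (P *ᵥ z)) = -(μ * (t * (u ⬝ᵥ w))) := by linear_combination μ * hux
    have h10 : 0 < t * -((P *ᵥ u) ⬝ᵥ (A *ᵥ v) + u ⬝ᵥ (Aᵀ *ᵥ w)) := mul_pos ht (by linarith)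
    linarith
  refine ⟨contDiff_quadratic P, by simp, hpos, fun x hx0 => ?_⟩
  have h8 := hmax x
  have h9 : x ⬝ᵥ (Aᵀ *ᵥ (P *ᵥ x)) = (P *ᵥ x) ⬝ᵥ (A *ᵥ x) := by
    rw [Matrix.mulVec_transpose, dotProduct_comm, ← Matrix.dotProduct_mulVec]
  rw [hform, h9, ← two_mul] at h8
  rw [fderiv_quadratic hP]
  exact h8.trans_lt (mul_neg_of_neg_of_pos hμ (hpos x hx0))

end IceCream

theorem mainTheorem2 (m : ℕ) (A : Matrix (Fin (m + 1)) (Fin (m + 1)) ℝ)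
    (hM : A ∈ IceCream.invariantMatrices (IceCream.iceCreamCone m))
    (hA : IceCream.IsHurwitz A) :
    ∃ P : Matrix (Fin (m + 1)) (Fin (m + 1)) ℝ,
      (P = 1 ∨ ∃ b : EuclideanSpace ℝ (Fin m), b ≠ 0 ∧ P = IceCream.boostMatrix b) ∧
      IceCream.IsLyapunovFunction A (fun x => x ⬝ᵥ (P *ᵥ x)) := by
  open IceCream in
  have hcross := crossPositive_of_mem_invariantMatrices hM
  have hdet := fun (l : ℝ) (hl : 0 ≤ l) => hA.det_ne_zero hl
  have hdetT : ∀ l : ℝ, 0 ≤ l →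
      (l • (1 : Matrix (Fin (m + 1)) (Fin (m + 1)) ℝ) - Aᵀ).det ≠ 0 := by
    intro l hl
    rw [← Matrix.det_transpose, Matrix.transpose_sub, Matrix.transpose_smul, Matrix.transpose_one,
      Matrix.transpose_transpose]
    exact hdet l hl
  obtain ⟨v, hv, hqv, c, hc, hAv⟩ := hcross.exists_hyperboloid hdet
  obtain ⟨w, hw, hqw, c', hc', hAw⟩ := hcross.transpose.exists_hyperboloid hdetT
  have hAv' : 0 ≤ gap (-(A *ᵥ v)) := by
    rw [hAv, neg_neg, gap_smul hc.le, gap_axis, mul_one]; exact hc.le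
  have hAw' : 0 < gap (-(Aᵀ *ᵥ w)) := by
    rw [hAw, neg_neg, gap_smul hc'.le, gap_axis, mul_one]; exact hc'
  -- On the hyperboloid, vectors with equal spatial parts coincide, and no boost is needed.
  by_cases hne : spatial v = spatial w
  · have hvw : v = w := by
      refine ext_spatial hne ((sq_eq_sq₀ ?_ ?_).1 (by rw [hqv, hqw, hne]))
      · exact (norm_nonneg _).trans (sub_pos.1 hv).le
      · exact (norm_nonneg _).trans (sub_pos.1 hw).le
    refine ⟨1, Or.inl rfl, isLyapunovFunction_of_mulVec_eq hcross Matrix.transpose_one ?_ ?_ ?_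
      hv hw (by rw [Matrix.one_mulVec, hvw]) hAv' hAw'⟩
    · intro x hx
      rw [Matrix.one_mulVec]
      exact lt_of_le_of_ne (Finset.sum_nonneg fun i _ => mul_self_nonneg (x i)) fun h => hx (dotProduct_self_eq_zero.1 h.symm)
    · intro x hx; rwa [Matrix.one_mulVec]
    · intro x hx; rwa [Matrix.one_mulVec]
  · obtain ⟨b, hb, hbv⟩ := exists_boostMatrix_mulVec_eq hv hw hqv hqw hne
    exact ⟨boostMatrix b, Or.inr ⟨b, hb, rfl⟩, isLyapunovFunction_of_mulVec_eq hcross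
      (boostMatrix_transpose b) (fun _ => boostMatrix_posDef hb)
      (fun _ => gap_nonneg_boostMatrix hb) (fun _ => gap_boostMatrix_eq_zero hb)
      hv hw hbv hAv' hAw'⟩
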